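/- Let $\mathfrak A$ be a (not necessarily unital) C*-algebra, let $\mathbb Z_2=\{1,-1\}$, and let $\alpha:\mathbb Z_2\to{}^*\mathrm{Aut}(\mathfrak A)$ be a group homomorphism (so that $(\mathfrak A,\mathbb Z_2,\alpha)$ is a C*-dynamical system). Let $\mathfrak A^{\mathbb Z_2}$ be the *-algebra of all functions $f:\mathbb Z_2\to\mathfrak A$ with pointwise addition and scalar multiplication, the multiplication $$(fg)(s)=\tfrac12\sum_{r\in\mathbb Z_2}f(r)\,\alpha_r\big(g(r^{-1}s)\big)$$ and the involution $f^*(s)=\alpha_s\big(f(s^{-1})^*\big)$. A covariant representation $(\mathcal H,\pi,U)$ consists of a complex Hilbert space $\mathcal H$, a *-homomorphism $\pi:\mathfrak A\to\mathcal L(\mathcal H)$ and a unitary representation $U$ of $\mathbb Z_2$ on $\mathcal H$ such that $\pi(\alpha_s(A))=U_s\pi(A)U_s^*$ for all $s\in\mathbb Z_2$ and $A\in\mathfrak A$; its integrated form is $(\pi\rtimes U)(f)=\frac12\sum_{s\in\mathbb Z_2}\pi(f(s))U_s$. The crossed product $\mathfrak A\rtimes_\alpha\mathbb Z_2$ is the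 C*-algebra obtained by completing $\mathfrak A^{\mathbb Z_2}$ with respect to the universal norm $\|f\|=\sup_{(\mathcal H,\pi,U)}\|(\pi\rtimes U)(f)\|$, the supremum being over all covariant representations. Write $\cong$ for the existence of a *-isomorphism. Then: (a) If $\mathfrak B$ is a C*-algebra such that $\mathfrak B\cong\mathfrak A^{\mathbb Z_2}$ as *-algebras, then $\mathfrak A\rtimes_\alpha\mathbb Z_2\cong\mathfrak B$. (b) $\mathfrak A\rtimes_\alpha\mathbb Z_2\cong\widehat{\mathfrak A}$, where $$\widehat{\mathfrak A}=\left\{\begin{bmatrix}A&B\\ \alpha_{-1}(B)&\alpha_{-1}(A)\end{bmatrix}\;\middle|\;A,B\in\mathfrak A\right\}$$ is a C*-subalgebra of the C*-algebra $\mathfrak A^{2\times2}$ of $2\times2$ matrices over $\mathfrak A$. -/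

import Mathlib

universe u v

noncomputable section

namespace Z2Crossed

variable {A : Type u} [NonUnitalCStarAlgebra A]

/-! The group `ℤ₂ = {1, -1}` is `ℤˣ`, and an action of `ℤ₂` on the C*-algebra `A` by
*-automorphisms is a group homomorphism `α : ℤˣ →* (A ≃⋆ₐ[ℂ] A)`; it is automatically strongly
continuous because `ℤ₂` is finite and discrete. -/

lemma sum_units {M : Type*} [AddCommMonoid M] (f : ℤˣ → M) : ∑ s, f s = f 1 + f (-1) := by
  rw [UnitsInt.univ]
  exact Finset.sum_pair (by decide)

lemma act_one (α : ℤˣ →* (A ≃⋆ₐ[ℂ] A)) (a : A) : α 1 a = a := by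
  rw [map_one]; rfl

lemma act_act (α : ℤˣ →* (A ≃⋆ₐ[ℂ] A)) (r s : ℤˣ) (a : A) : α r (α s a) = α (r * s) a := by
  rw [map_mul]; rfl

lemma neg_one_inv : (-1 : ℤˣ)⁻¹ = -1 := rfl

/-- The complex vector space `A^{ℤ₂}` of all functions `ℤ₂ → A`. It depends on `α` through the
multiplication and the involution that it carries below. -/
def ConvAlg (_α : ℤˣ →* (A ≃⋆ₐ[ℂ] A)) : Type u := ℤˣ → A

namespace ConvAlg

variable (α : ℤˣ →* (A ≃⋆ₐ[ℂ] A))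

instance instAddCommGroup : AddCommGroup (ConvAlg α) := inferInstanceAs (AddCommGroup (ℤˣ → A))

instance instModule : Module ℂ (ConvAlg α) := inferInstanceAs (Module ℂ (ℤˣ → A))

/-- The convolution product with respect to the normalized Haar measure of `ℤ₂`. -/
instance instMul : Mul (ConvAlg α) where
  mul f g := fun s => (1 / 2 : ℂ) • ∑ r : ℤˣ, f r * α r (g (r⁻¹ * s))

/-- The involution (the group `ℤ₂` is unimodular). -/
instance instStar : Star (ConvAlg α) where
  star f := fun s => α s (star (f s⁻¹))

variable {α}

@[ext] lemma ext {f g : ConvAlg α} (h : ∀ s : ℤˣ, f s = g s) : f = g := funext h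

@[simp] lemma add_apply (f g : ConvAlg α) (s : ℤˣ) : (f + g) s = f s + g s := rfl

@[simp] lemma zero_apply (s : ℤˣ) : (0 : ConvAlg α) s = 0 := rfl

@[simp] lemma neg_apply (f : ConvAlg α) (s : ℤˣ) : (-f) s = -f s := rfl

@[simp] lemma smul_apply (c : ℂ) (f : ConvAlg α) (s : ℤˣ) : (c • f) s = c • f s := rfl

lemma mul_apply (f g : ConvAlg α) (s : ℤˣ) :
    (f * g) s = (1 / 2 : ℂ) • ∑ r : ℤˣ, f r * α r (g (r⁻¹ * s)) := rfl

lemma star_apply (f : ConvAlg α) (s : ℤˣ) : (star f) s = α s (star (f s⁻¹)) := rfl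

instance instNonUnitalRing : NonUnitalRing (ConvAlg α) where
  left_distrib f g h := by
    ext s
    simp [mul_apply, mul_add, Finset.sum_add_distrib]
  right_distrib f g h := by
    ext s
    simp [mul_apply, add_mul, Finset.sum_add_distrib]
  zero_mul f := by ext s; simp [mul_apply]
  mul_zero f := by ext s; simp [mul_apply]
  mul_assoc f g h := by
    ext s
    simp only [mul_apply, Finset.smul_sum, Finset.sum_mul, Finset.mul_sum, map_sum, map_smul,
      map_mul, act_act, smul_mul_assoc, mul_smul_comm]
    rw [Finset.sum_comm]
    refine Finset.sum_congr rfl fun r _ => ?_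
    refine Fintype.sum_equiv (Equiv.mulLeft r⁻¹) _ _ fun t => ?_
    simp only [Equiv.coe_mulLeft, mul_inv_rev, inv_inv, mul_assoc, StarAlgEquiv.mul_apply,
      act_act, mul_inv_cancel_left]

instance instStarRing : StarRing (ConvAlg α) where
  star_involutive f := by
    ext s
    simp [star_apply, ← map_star, act_act]
  star_mul f g := by
    ext s
    simp only [star_apply, mul_apply, star_smul, star_sum, star_mul, map_smul, map_sum, map_mul,
      ← map_star, act_act]
    have h : star (1 / 2 : ℂ) = 1 / 2 := by simp
    rw [h]
    congr 1
    refine Fintype.sum_equiv (Equiv.mulLeft s) _ _ fun t => ?_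
    simp only [Equiv.coe_mulLeft, mul_inv_rev, inv_inv, mul_assoc, StarAlgEquiv.mul_apply,
      act_act, mul_inv_cancel, inv_mul_cancel, mul_one]
  star_add f g := by ext s; simp [star_apply]

instance instStarModule : StarModule ℂ (ConvAlg α) where
  star_smul c f := by ext s; simp [star_apply]

instance instIsScalarTower : IsScalarTower ℂ (ConvAlg α) (ConvAlg α) where
  smul_assoc c f g := by
    ext s
    simp only [smul_eq_mul, mul_apply, smul_apply, smul_mul_assoc, ← Finset.smul_sum]
    rw [smul_comm]

instance instSMulCommClass : SMulCommClass ℂ (ConvAlg α) (ConvAlg α) where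
  smul_comm c f g := by
    ext s
    simp only [smul_eq_mul, mul_apply, smul_apply, map_smul, mul_smul_comm, ← Finset.smul_sum]
    rw [smul_comm]

end ConvAlg

/-- A covariant representation `(H, π, U)` of `(A, ℤ₂, α)`. -/
structure CovRep (α : ℤˣ →* (A ≃⋆ₐ[ℂ] A)) where
  /-- the complex Hilbert space -/
  H : Type u
  [normedAddCommGroup : NormedAddCommGroup H]
  [innerProductSpace : InnerProductSpace ℂ H]
  [completeSpace : CompleteSpace H]
  /-- the representation of the C*-algebra -/
  π : A →⋆ₙₐ[ℂ] (H →L[ℂ] H)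
  /-- the unitary representation of `ℤ₂` -/
  U : ℤˣ →* unitary (H →L[ℂ] H)
  covariant : ∀ (s : ℤˣ) (a : A),
    π (α s a) = (U s : H →L[ℂ] H) * π a * star (U s : H →L[ℂ] H)

attribute [instance] CovRep.normedAddCommGroup CovRep.innerProductSpace CovRep.completeSpace

namespace CovRep

variable {α : ℤˣ →* (A ≃⋆ₐ[ℂ] A)} (ρ : CovRep α)

lemma U_mul_π (s : ℤˣ) (a : A) :
    (ρ.U s : ρ.H →L[ℂ] ρ.H) * ρ.π a = ρ.π (α s a) * (ρ.U s : ρ.H →L[ℂ] ρ.H) := by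
  rw [ρ.covariant, mul_assoc, Unitary.coe_star_mul_self, mul_one]

lemma star_U (s : ℤˣ) :
    star (ρ.U s : ρ.H →L[ℂ] ρ.H) = (ρ.U s⁻¹ : ρ.H →L[ℂ] ρ.H) := by
  rw [map_inv]; rfl

/-- The integrated form `π ⋊ U` of a covariant representation, with respect to the normalized
Haar measure of `ℤ₂`. -/
def integratedForm : ConvAlg α →⋆ₙₐ[ℂ] (ρ.H →L[ℂ] ρ.H) where
  toFun f := (1 / 2 : ℂ) • ∑ s : ℤˣ, ρ.π (f s) * (ρ.U s : ρ.H →L[ℂ] ρ.H)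
  map_smul' c f := by
    simp only [ConvAlg.smul_apply, map_smul, smul_mul_assoc, ← Finset.smul_sum,
      MonoidHom.id_apply]
    rw [smul_comm]
  map_zero' := by simp
  map_add' f g := by
    simp [add_mul, Finset.sum_add_distrib]
  map_mul' f g := by
    simp only [ConvAlg.mul_apply, Finset.smul_sum, Finset.sum_mul, Finset.mul_sum, map_sum,
      map_smul, map_mul, smul_mul_assoc, mul_smul_comm]
    rw [Finset.sum_comm]
    conv_rhs => rw [Finset.sum_comm]
    refine Finset.sum_congr rfl fun r _ => ?_
    refine Fintype.sum_equiv (Equiv.mulLeft r⁻¹) _ _ fun t => ?_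
    have h : (ρ.U t : ρ.H →L[ℂ] ρ.H) = (ρ.U r : ρ.H →L[ℂ] ρ.H) * (ρ.U (r⁻¹ * t)) := by
      rw [← Submonoid.coe_mul, ← map_mul, mul_inv_cancel_left]
    simp only [Equiv.coe_mulLeft]
    rw [h, mul_assoc, ← mul_assoc (ρ.π (α r _)), ← U_mul_π]
    simp only [mul_assoc]
  map_star' f := by
    have h : star (1 / 2 : ℂ) = 1 / 2 := by simp
    simp only [ConvAlg.star_apply, star_smul, star_sum, star_mul, h, star_U, ← map_star, U_mul_π]
    congr 1

lemma integratedForm_apply (f : ConvAlg α) :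
    ρ.integratedForm f = (1 / 2 : ℂ) • ∑ s : ℤˣ, ρ.π (f s) * (ρ.U s : ρ.H →L[ℂ] ρ.H) := rfl

lemma norm_integratedForm_le (f : ConvAlg α) :
    ‖ρ.integratedForm f‖ ≤ (1 / 2 : ℝ) * ∑ s : ℤˣ, ‖f s‖ := by
  rw [integratedForm_apply, norm_smul]
  have h : ‖(1 / 2 : ℂ)‖ = 1 / 2 := by simp
  rw [h]
  gcongr
  refine (norm_sum_le _ _).trans (Finset.sum_le_sum fun s _ => ?_)
  rw [CStarRing.norm_mul_coe_unitary]
  exact NonUnitalStarAlgHom.norm_apply_le ρ.π (f s)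

end CovRep

namespace ConvAlg

variable {α : ℤˣ →* (A ≃⋆ₐ[ℂ] A)}

/-- The universal norm: the supremum of `‖(π ⋊ U)(f)‖` over all covariant representations. -/
def univNorm (f : ConvAlg α) : ℝ := ⨆ ρ : CovRep α, ‖ρ.integratedForm f‖

lemma bddAbove_univNorm (f : ConvAlg α) :
    BddAbove (Set.range fun ρ : CovRep α => ‖ρ.integratedForm f‖) := by
  refine ⟨(1 / 2 : ℝ) * ∑ s : ℤˣ, ‖f s‖, ?_⟩
  rintro _ ⟨ρ, rfl⟩
  exact ρ.norm_integratedForm_le f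

lemma le_univNorm (ρ : CovRep α) (f : ConvAlg α) : ‖ρ.integratedForm f‖ ≤ univNorm f :=
  le_ciSup (bddAbove_univNorm f) ρ

lemma univNorm_nonneg (f : ConvAlg α) : 0 ≤ univNorm f :=
  Real.iSup_nonneg fun _ => norm_nonneg _

lemma univNorm_le {f : ConvAlg α} {c : ℝ} (hc : 0 ≤ c)
    (h : ∀ ρ : CovRep α, ‖ρ.integratedForm f‖ ≤ c) : univNorm f ≤ c :=
  Real.iSup_le h hc

instance instSeminormedAddCommGroup : SeminormedAddCommGroup (ConvAlg α) :=
  AddGroupSeminorm.toSeminormedAddCommGroup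
    { toFun := univNorm
      map_zero' := by simp [univNorm]
      add_le' := fun f g => by
        refine univNorm_le (add_nonneg (univNorm_nonneg f) (univNorm_nonneg g)) fun ρ => ?_
        rw [map_add]
        exact (norm_add_le _ _).trans (add_le_add (le_univNorm ρ f) (le_univNorm ρ g))
      neg' := fun f => by simp [univNorm] }

lemma norm_def (f : ConvAlg α) : ‖f‖ = ⨆ ρ : CovRep α, ‖ρ.integratedForm f‖ := rfl

instance instNonUnitalSeminormedRing : NonUnitalSeminormedRing (ConvAlg α) where
  __ := instSeminormedAddCommGroup
  __ := instNonUnitalRing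
  norm_mul_le f g := by
    refine univNorm_le (mul_nonneg (univNorm_nonneg f) (univNorm_nonneg g)) fun ρ => ?_
    rw [map_mul]
    exact (norm_mul_le _ _).trans
      (mul_le_mul (le_univNorm ρ f) (le_univNorm ρ g) (norm_nonneg _) (univNorm_nonneg f))

instance instNormedSpace : NormedSpace ℂ (ConvAlg α) where
  norm_smul_le c f := by
    refine univNorm_le (mul_nonneg (norm_nonneg c) (univNorm_nonneg f)) fun ρ => ?_
    rw [map_smul, norm_smul]
    exact mul_le_mul_of_nonneg_left (le_univNorm ρ f) (norm_nonneg c)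

lemma norm_star (f : ConvAlg α) : ‖star f‖ = ‖f‖ := by
  simp only [norm_def, map_star, _root_.norm_star]

lemma norm_mul_self_le (f : ConvAlg α) : ‖f‖ * ‖f‖ ≤ ‖star f * f‖ := by
  have h : ‖f‖ ≤ √‖star f * f‖ := by
    refine univNorm_le (Real.sqrt_nonneg _) fun ρ => Real.le_sqrt_of_sq_le ?_
    rw [sq, ← CStarRing.norm_star_mul_self, ← map_star, ← map_mul]
    exact le_univNorm ρ _
  calc ‖f‖ * ‖f‖ ≤ √‖star f * f‖ * √‖star f * f‖ := by gcongr
    _ = ‖star f * f‖ := Real.mul_self_sqrt (norm_nonneg _)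

lemma isometry_star : Isometry (star : ConvAlg α → ConvAlg α) :=
  AddMonoidHomClass.isometry_of_norm (starAddEquiv : ConvAlg α ≃+ ConvAlg α) norm_star

end ConvAlg

/-- The crossed product `A ⋊_α ℤ₂`: the (Hausdorff) completion of the *-algebra `A^{ℤ₂}` with
respect to the universal norm. -/
def CrossedProduct (α : ℤˣ →* (A ≃⋆ₐ[ℂ] A)) : Type u := UniformSpace.Completion (ConvAlg α)

namespace CrossedProduct

open UniformSpace

variable {α : ℤˣ →* (A ≃⋆ₐ[ℂ] A)}

instance instNormedAddCommGroup : NormedAddCommGroup (CrossedProduct α) :=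
  inferInstanceAs (NormedAddCommGroup (Completion (ConvAlg α)))

instance instNormedSpace : NormedSpace ℂ (CrossedProduct α) :=
  inferInstanceAs (NormedSpace ℂ (Completion (ConvAlg α)))

instance instCompleteSpace : CompleteSpace (CrossedProduct α) :=
  inferInstanceAs (CompleteSpace (Completion (ConvAlg α)))

/-- The canonical map `E : A^{ℤ₂} → A ⋊_α ℤ₂`. -/
def ι : ConvAlg α →ₗᵢ[ℂ] CrossedProduct α := Completion.toComplₗᵢ

lemma isDenseInducing_ι : IsDenseInducing (ι : ConvAlg α → CrossedProduct α) :=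
  Completion.isDenseInducing_coe

lemma denseRange_ι : DenseRange (ι : ConvAlg α → CrossedProduct α) := isDenseInducing_ι.dense

/-- The multiplication is the continuous extension of the multiplication of `A^{ℤ₂}`. -/
instance instMul : Mul (CrossedProduct α) where
  mul x y := (isDenseInducing_ι.prodMap isDenseInducing_ι).extend
    (fun p : ConvAlg α × ConvAlg α => (ι (p.1 * p.2) : CrossedProduct α)) (x, y)

/-- The involution is the continuous extension of the involution of `A^{ℤ₂}`. -/
instance instStar : Star (CrossedProduct α) where
  star x := isDenseInducing_ι.extend (fun f : ConvAlg α => (ι (star f) : CrossedProduct α)) x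

lemma ι_mul (f g : ConvAlg α) : (ι (f * g) : CrossedProduct α) = ι f * ι g :=
  ((isDenseInducing_ι.prodMap isDenseInducing_ι).extend_eq
    (ι.continuous.comp continuous_mul) (f, g)).symm

lemma ι_star (f : ConvAlg α) : (ι (star f) : CrossedProduct α) = star (ι f) :=
  (isDenseInducing_ι.extend_eq
    (ι.continuous.comp ConvAlg.isometry_star.continuous) f).symm

instance instContinuousMul : ContinuousMul (CrossedProduct α) where
  continuous_mul := by
    let e : ConvAlg α →+ CrossedProduct α := (ι : ConvAlg α →ₗᵢ[ℂ] CrossedProduct α)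
    let m := (AddMonoidHom.mul : ConvAlg α →+ ConvAlg α →+ ConvAlg α).compr₂ e
    have hm : Continuous fun p : ConvAlg α × ConvAlg α => m p.1 p.2 :=
      ι.continuous.comp continuous_mul
    have di : IsDenseInducing e := isDenseInducing_ι
    exact (di.extend_Z_bilin di hm :)

instance instContinuousStar : ContinuousStar (CrossedProduct α) where
  continuous_star := by
    have h : UniformContinuous (fun f : ConvAlg α => (ι (star f) : CrossedProduct α)) :=
      ι.isometry.uniformContinuous.comp ConvAlg.isometry_star.uniformContinuous
    exact (uniformContinuous_uniformly_extend ι.isometry.isUniformInducing denseRange_ι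
      h).continuous

instance instNonUnitalRing : NonUnitalRing (CrossedProduct α) where
  zero_mul x := by
    refine denseRange_ι.induction_on x (isClosed_eq (by fun_prop) (by fun_prop)) fun f => ?_
    rw [← map_zero ι, ← ι_mul, zero_mul]
  mul_zero x := by
    refine denseRange_ι.induction_on x (isClosed_eq (by fun_prop) (by fun_prop)) fun f => ?_
    rw [← map_zero ι, ← ι_mul, mul_zero]
  mul_assoc x y z := by
    refine denseRange_ι.induction_on₃ (isClosed_eq (by fun_prop) (by fun_prop))
      (fun f g h => ?_) x y z
    simp only [← ι_mul, mul_assoc]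
  left_distrib x y z := by
    refine denseRange_ι.induction_on₃ (isClosed_eq (by fun_prop) (by fun_prop))
      (fun f g h => ?_) x y z
    simp only [← ι_mul, ← map_add, mul_add]
  right_distrib x y z := by
    refine denseRange_ι.induction_on₃ (isClosed_eq (by fun_prop) (by fun_prop))
      (fun f g h => ?_) x y z
    simp only [← ι_mul, ← map_add, add_mul]

instance instNonUnitalNormedRing : NonUnitalNormedRing (CrossedProduct α) where
  __ := instNormedAddCommGroup
  __ := instNonUnitalRing
  norm_mul_le x y := by
    refine denseRange_ι.induction_on₂ (p := fun x y : CrossedProduct α => ‖x * y‖ ≤ ‖x‖ * ‖y‖)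
      (isClosed_le (by fun_prop) (by fun_prop)) (fun f g => ?_) x y
    simp only [← ι_mul, LinearIsometry.norm_map]
    exact norm_mul_le f g

instance instStarRing : StarRing (CrossedProduct α) where
  star_involutive x := by
    refine denseRange_ι.induction_on x (isClosed_eq (by fun_prop) (by fun_prop)) fun f => ?_
    rw [← ι_star, ← ι_star, star_star]
  star_mul x y := by
    refine denseRange_ι.induction_on₂ (isClosed_eq (by fun_prop) (by fun_prop))
      (fun f g => ?_) x y
    simp only [← ι_star, ← ι_mul, star_mul]
  star_add x y := by
    refine denseRange_ι.induction_on₂ (isClosed_eq (by fun_prop) (by fun_prop))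
      (fun f g => ?_) x y
    simp only [← ι_star, ← map_add, star_add]

instance instCStarRing : CStarRing (CrossedProduct α) where
  norm_mul_self_le x := by
    refine denseRange_ι.induction_on x (isClosed_le (by fun_prop) (by fun_prop)) fun f => ?_
    simp only [← ι_star, ← ι_mul, LinearIsometry.norm_map]
    exact ConvAlg.norm_mul_self_le f

lemma smul_mul_aux (c : ℂ) (x y : CrossedProduct α) : (c • x) * y = c • (x * y) := by
  refine denseRange_ι.induction_on₂
    (p := fun x y : CrossedProduct α => (c • x) * y = c • (x * y))
    (isClosed_eq ((continuous_fst.const_smul c).mul continuous_snd)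
      ((continuous_fst.mul continuous_snd).const_smul c)) (fun f g => ?_) x y
  rw [← ι_mul, ← LinearIsometry.map_smul, ← LinearIsometry.map_smul, ← ι_mul, smul_mul_assoc]

lemma mul_smul_aux (c : ℂ) (x y : CrossedProduct α) : x * (c • y) = c • (x * y) := by
  refine denseRange_ι.induction_on₂
    (p := fun x y : CrossedProduct α => x * (c • y) = c • (x * y))
    (isClosed_eq (continuous_fst.mul (continuous_snd.const_smul c))
      ((continuous_fst.mul continuous_snd).const_smul c)) (fun f g => ?_) x y
  rw [← ι_mul, ← LinearIsometry.map_smul, ← LinearIsometry.map_smul, ← ι_mul, mul_smul_comm]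

lemma star_smul_aux (c : ℂ) (x : CrossedProduct α) : star (c • x) = star c • star x := by
  refine denseRange_ι.induction_on
    (p := fun x : CrossedProduct α => star (c • x) = star c • star x) x
    (isClosed_eq (continuous_id.const_smul c).star (continuous_id.star.const_smul (star c)))
    fun f => ?_
  rw [← ι_star, ← LinearIsometry.map_smul, ← LinearIsometry.map_smul, ← ι_star, star_smul]

/-- The crossed product is a C*-algebra. -/
instance instNonUnitalCStarAlgebra : NonUnitalCStarAlgebra (CrossedProduct α) where
  smul_assoc c x y := smul_mul_aux c x y
  smul_comm c x y := (mul_smul_aux c x y).symm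
  star_smul c x := star_smul_aux c x

end CrossedProduct

/-- The *-subalgebra `Â` of the C*-algebra of `2 × 2` matrices over `A`, consisting of the matrices
`[[a, b], [α₋₁(b), α₋₁(a)]]`. -/
def hatAlg (α : ℤˣ →* (A ≃⋆ₐ[ℂ] A)) :
    NonUnitalStarSubalgebra ℂ (CStarMatrix (Fin 2) (Fin 2) A) where
  carrier := {X | ∃ a b : A, X = CStarMatrix.ofMatrix !![a, b; α (-1) b, α (-1) a]}
  zero_mem' := ⟨0, 0, by ext i j; fin_cases i <;> fin_cases j <;> simp⟩
  add_mem' := by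
    rintro _ _ ⟨a, b, rfl⟩ ⟨c, d, rfl⟩
    exact ⟨a + c, b + d, by ext i j; fin_cases i <;> fin_cases j <;> simp⟩
  smul_mem' := by
    rintro c _ ⟨a, b, rfl⟩
    exact ⟨c • a, c • b, by ext i j; fin_cases i <;> fin_cases j <;> simp⟩
  mul_mem' := by
    rintro _ _ ⟨a, b, rfl⟩ ⟨c, d, rfl⟩
    refine ⟨a * c + b * α (-1) d, a * d + b * α (-1) c, ?_⟩
    ext i j
    fin_cases i <;> fin_cases j <;>
      simp [CStarMatrix.mul_apply, Fin.sum_univ_two, act_act, add_comm]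
  star_mem' := by
    rintro _ ⟨a, b, rfl⟩
    refine ⟨star a, α (-1) (star b), ?_⟩
    ext i j
    fin_cases i <;> fin_cases j <;>
      simp [CStarMatrix.star_apply, ← map_star, act_act]

lemma mem_hatAlg {α : ℤˣ →* (A ≃⋆ₐ[ℂ] A)} {X : CStarMatrix (Fin 2) (Fin 2) A} :
    X ∈ hatAlg α ↔ ∃ a b : A, X = CStarMatrix.ofMatrix !![a, b; α (-1) b, α (-1) a] := Iff.rfl

/-- `Â` is closed in the C*-algebra of `2 × 2` matrices, hence a C*-subalgebra. -/
instance isClosed_hatAlg (α : ℤˣ →* (A ≃⋆ₐ[ℂ] A)) :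
    IsClosed (hatAlg α : Set (CStarMatrix (Fin 2) (Fin 2) A)) := by
  have h : (hatAlg α : Set (CStarMatrix (Fin 2) (Fin 2) A)) =
      {X | X 1 0 = α (-1) (X 0 1)} ∩ {X | X 1 1 = α (-1) (X 0 0)} := by
    ext X
    constructor
    · rintro ⟨a, b, rfl⟩
      simp
    · rintro ⟨h₁, h₂⟩
      refine ⟨X 0 0, X 0 1, ?_⟩
      change X 1 0 = _ at h₁
      change X 1 1 = _ at h₂
      ext i j
      fin_cases i <;> fin_cases j <;> simp [h₁, h₂]
  have hα : Continuous (α (-1)) := (NonUnitalStarAlgHom.isometry (F := A ≃⋆ₐ[ℂ] A) (α (-1))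
    (α (-1)).injective).continuous
  have hX (i j : Fin 2) : Continuous fun X : CStarMatrix (Fin 2) (Fin 2) A => X i j :=
    (continuous_apply j).comp (continuous_apply i : Continuous fun X : Fin 2 → Fin 2 → A => X i)
  rw [h]
  exact (isClosed_eq (hX 1 0) (hα.comp (hX 0 1))).inter
    (isClosed_eq (hX 1 1) (hα.comp (hX 0 0)))

/-- `Â` is a C*-algebra with the norm of the C*-algebra of `2 × 2` matrices over `A`. -/
instance instNonUnitalCStarAlgebraHatAlg [PartialOrder A] [StarOrderedRing A]
    (α : ℤˣ →* (A ≃⋆ₐ[ℂ] A)) : NonUnitalCStarAlgebra (hatAlg α) :=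
  NonUnitalStarSubalgebra.nonUnitalCStarAlgebra (hatAlg α) (h_closed := isClosed_hatAlg α)

end Z2Crossed

end

/-! By Hahn-Banach and the GNS construction, for every element `b` of a unital C*-algebra some
Hilbert space representation `σ` has `‖b‖ ≤ ‖σ b‖`. Hence the integrated form of a covariant
homomorphism into any unital C*-algebra is bounded by the universal norm. For the regular covariant
homomorphism, by `2 × 2` matrices over the unitization of `A`, the entries of the integrated form
have norm `½ ‖f s‖`, so `½ ‖f s‖ ≤ ‖f‖ ≤ ½ ∑ s, ‖f s‖` and the universal norm is equivalent to the
supremum norm. Thus `A^{ℤ₂}` is already Hausdorff and complete, the canonical map into the crossed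
product is a *-isomorphism, and both claims are statements about the *-algebra `A^{ℤ₂}`. -/

noncomputable section

namespace Z2Crossed

open ComplexOrder ComplexStarModule

/-- The complex linear functional `x ↦ g (ℜ x) + i g (ℑ x)`: it is real on self-adjoint elements,
where it agrees with the real functional `g` it is built from. -/
def selfAdjointExtension {B : Type*} [AddCommGroup B] [StarAddMonoid B] [Module ℂ B]
    [StarModule ℂ B] (g : Module.Dual ℝ B) : Module.Dual ℂ B :=
  Module.Dual.extendRCLike (g ∘ₗ (selfAdjoint.submodule ℝ B).subtype ∘ₗ ℜ)

lemma selfAdjointExtension_apply_of_isSelfAdjoint {B : Type*} [AddCommGroup B]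
    [StarAddMonoid B] [Module ℂ B] [StarModule ℂ B] (g : Module.Dual ℝ B) {x : B}
    (hx : IsSelfAdjoint x) :
    selfAdjointExtension g x = g x := by
  change (g (ℜ x : B) : ℂ) - Complex.I * (g (ℜ (Complex.I • x) : B) : ℂ) = g x
  simp [realPart_I_smul, hx.coe_realPart, hx.imaginaryPart]

section State

variable {B : Type*} [CStarAlgebra B] [PartialOrder B] [StarOrderedRing B]

lemma norm_norm_smul_one_sub_le {b : B} (hb : 0 ≤ b) : ‖‖b‖ • (1 : B) - b‖ ≤ ‖b‖ := by
  have h : b ≤ algebraMap ℝ B ‖b‖ := (IsSelfAdjoint.of_nonneg hb).le_algebraMap_norm_self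
  rw [← Algebra.algebraMap_eq_smul_one,
    CStarAlgebra.norm_le_iff_le_algebraMap _ (norm_nonneg b) (sub_nonneg.mpr h)]
  exact sub_le_self _ hb

lemma norm_one_add_of_nonneg [Nontrivial B] {b : B} (hb : 0 ≤ b) : ‖1 + b‖ = 1 + ‖b‖ := by
  refine le_antisymm ((norm_add_le _ _).trans_eq (by rw [CStarRing.norm_one])) ?_
  have h_one : 1 ≤ ‖1 + b‖ := by
    simpa using CStarAlgebra.norm_le_norm_of_nonneg_of_le zero_le_one (le_add_of_nonneg_right hb)
  have h_add : 1 + b ≤ algebraMap ℝ B ‖1 + b‖ :=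
    (IsSelfAdjoint.of_nonneg (add_nonneg zero_le_one hb)).le_algebraMap_norm_self
  rw [← le_sub_iff_add_le', CStarAlgebra.norm_le_iff_le_algebraMap _ (sub_nonneg.mpr h_one) hb,
    map_sub, map_one]
  exact le_sub_iff_add_le'.mpr h_add

lemma apply_nonneg_of_opNorm_le_one {g : StrongDual ℝ B} (hg : ‖g‖ ≤ 1) (hg_one : g 1 = 1)
    {b : B} (hb : 0 ≤ b) : 0 ≤ g b := by
  have h := (le_abs_self _).trans <| (g.le_of_opNorm_le hg _).trans <|
    (one_mul _).trans_le (norm_norm_smul_one_sub_le hb)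
  simpa [hg_one] using h

lemma exists_positiveLinearMap_apply_eq_norm [Nontrivial B] {b : B} (hb : 0 ≤ b) :
    ∃ φ : B →ₚ[ℂ] ℂ, φ 1 = 1 ∧ φ b = ‖b‖ := by
  -- As `‖1 + b‖ = 1 + ‖b‖`, a functional of norm at most `1` attaining the norm at `1 + b` attains
  -- it at both `1` and `b`.
  obtain ⟨g, hg, hg_add⟩ := exists_dual_vector'' ℝ (1 + b)
  have hg_add : g 1 + g b = 1 + ‖b‖ := by
    simpa [norm_one_add_of_nonneg hb] using hg_add
  have hg_le (x : B) : g x ≤ ‖x‖ :=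
    (le_abs_self _).trans <| (g.le_of_opNorm_le hg x).trans_eq (one_mul _)
  have hg_one_le : g 1 ≤ 1 := by simpa using hg_le 1
  have hg_one : g 1 = 1 := by linarith [hg_le b]
  have hg_b : g b = ‖b‖ := by linarith
  refine ⟨.mk₀ (selfAdjointExtension g) fun x hx => ?_, ?_, ?_⟩
  · rw [selfAdjointExtension_apply_of_isSelfAdjoint _ (.of_nonneg hx)]
    exact_mod_cast apply_nonneg_of_opNorm_le_one hg hg_one hx
  · exact (selfAdjointExtension_apply_of_isSelfAdjoint _ (.one B)).trans (by simp [hg_one])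
  · exact (selfAdjointExtension_apply_of_isSelfAdjoint _ (.of_nonneg hb)).trans (by simp [hg_b])

end State

lemma norm_gnsStarAlgHom_apply_one {B : Type*} [CStarAlgebra B] [PartialOrder B]
    [StarOrderedRing B] (φ : B →ₚ[ℂ] ℂ) (b : B) :
    ‖φ.gnsStarAlgHom b (φ.toPreGNS 1 : φ.PreGNS)‖ = √(φ (star b * b)).re := by
  change ‖φ.gnsNonUnitalStarAlgHom b _‖ = _
  rw [PositiveLinearMap.gnsNonUnitalStarAlgHom_apply_coe, UniformSpace.Completion.norm_coe,
    φ.preGNS_norm_def]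
  simp

lemma exists_starAlgHom_norm_le {B : Type u} [CStarAlgebra B] (b : B) :
    ∃ (H : Type u) (_ : NormedAddCommGroup H) (_ : InnerProductSpace ℂ H) (_ : CompleteSpace H)
      (σ : B →⋆ₐ[ℂ] (H →L[ℂ] H)), ‖b‖ ≤ ‖σ b‖ := by
  let _ : PartialOrder B := CStarAlgebra.spectralOrder B
  have : StarOrderedRing B := CStarAlgebra.spectralOrderedRing B
  obtain _ | _ := subsingleton_or_nontrivial B
  · let φ : B →ₚ[ℂ] ℂ := 0
    exact ⟨φ.GNS, _, _, inferInstance, φ.gnsStarAlgHom, by simp [Subsingleton.elim b 0]⟩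
  obtain ⟨φ, hφ_one, hφ_b⟩ := exists_positiveLinearMap_apply_eq_norm (star_mul_self_nonneg b)
  refine ⟨φ.GNS, _, _, inferInstance, φ.gnsStarAlgHom, ?_⟩
  let ξ : φ.GNS := (φ.toPreGNS 1 : φ.PreGNS)
  have hξ : ‖ξ‖ = 1 :=
    (UniformSpace.Completion.norm_coe _).trans (by simp [φ.preGNS_norm_def, hφ_one])
  calc ‖b‖ = ‖φ.gnsStarAlgHom b ξ‖ := by
        rw [norm_gnsStarAlgHom_apply_one, hφ_b, Complex.ofReal_re, CStarRing.norm_star_mul_self,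
          Real.sqrt_mul_self (norm_nonneg b)]
    _ ≤ ‖φ.gnsStarAlgHom b‖ * ‖ξ‖ := ContinuousLinearMap.le_opNorm _ _
    _ = ‖φ.gnsStarAlgHom b‖ := by rw [hξ, mul_one]

variable {A : Type u} [NonUnitalCStarAlgebra A] {α : ℤˣ →* (A ≃⋆ₐ[ℂ] A)}

/-- A covariant homomorphism of `(A, ℤ₂, α)` into a unital *-algebra `B`; a covariant
representation is the case in which `B` consists of the bounded operators on a Hilbert space. -/
structure CovHom (α : ℤˣ →* (A ≃⋆ₐ[ℂ] A)) (B : Type*) [Ring B] [StarRing B] [Algebra ℂ B] where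
  /-- the *-homomorphism on the C*-algebra -/
  π : A →⋆ₙₐ[ℂ] B
  /-- the unitary representation of `ℤ₂` -/
  U : ℤˣ →* unitary B
  covariant (s : ℤˣ) (a : A) : π (α s a) = (U s : B) * π a * star (U s : B)

namespace CovHom

section Algebra

variable {B : Type*} [Ring B] [StarRing B] [Algebra ℂ B]

/-- The integrated form `π ⋊ U` of a covariant homomorphism. -/
def integral (ψ : CovHom α B) (f : ConvAlg α) : B :=
  (1 / 2 : ℂ) • ∑ s : ℤˣ, ψ.π (f s) * (ψ.U s : B)

/-- The covariant homomorphism `(σ ∘ π, σ ∘ U)`. -/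
def map {C : Type*} [Ring C] [StarRing C] [Algebra ℂ C] (ψ : CovHom α B) (σ : B →⋆ₐ[ℂ] C) :
    CovHom α C where
  π := (σ : B →⋆ₙₐ[ℂ] C).comp ψ.π
  U := (Unitary.map (StarMonoidHom.ofClass σ)).toMonoidHom.comp ψ.U
  covariant s a := by
    change σ (ψ.π (α s a)) = σ (ψ.U s) * σ (ψ.π a) * star (σ (ψ.U s))
    rw [ψ.covariant, map_mul, map_mul, map_star]

lemma integral_map {C : Type*} [Ring C] [StarRing C] [Algebra ℂ C] (ψ : CovHom α B)
    (σ : B →⋆ₐ[ℂ] C) (f : ConvAlg α) : (ψ.map σ).integral f = σ (ψ.integral f) := by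
  simp only [integral, map_smul, map_sum, map_mul]
  rfl

end Algebra

/-- A covariant homomorphism into the bounded operators on `H`, as a covariant representation. -/
def toCovRep {H : Type u} [NormedAddCommGroup H] [InnerProductSpace ℂ H] [CompleteSpace H]
    (ψ : CovHom α (H →L[ℂ] H)) : CovRep α where
  H := H
  __ := ψ

lemma norm_integral_le {B : Type u} [CStarAlgebra B] (ψ : CovHom α B) (f : ConvAlg α) :
    ‖ψ.integral f‖ ≤ ‖f‖ := by
  obtain ⟨H, _, _, _, σ, hσ⟩ := exists_starAlgHom_norm_le (ψ.integral f)
  calc ‖ψ.integral f‖ ≤ ‖σ (ψ.integral f)‖ := hσ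
    _ = ‖(ψ.map σ).toCovRep.integratedForm f‖ := congrArg norm (ψ.integral_map σ f).symm
    _ ≤ ‖f‖ := ConvAlg.le_univNorm _ f

section Regular

variable {n B : Type*} [Fintype n] [DecidableEq n] [Ring B] [StarRing B]

/-- Permutation matrices as unitary matrices. -/
def permUnitary (n B : Type*) [Fintype n] [DecidableEq n] [Ring B] [StarRing B] :
    Equiv.Perm n →* unitary (Matrix n n B) :=
  Matrix.permMatrixHom.codRestrict (unitary (Matrix n n B)) fun σ => by
    simp [Unitary.mem_iff, Matrix.star_eq_conjTranspose, ← Matrix.permMatrix_mul]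

lemma permUnitary_mul_diagonal_mul_star (σ : Equiv.Perm n) (d : n → B) :
    (permUnitary n B σ : Matrix n n B) * Matrix.diagonal d * star (permUnitary n B σ : Matrix n n B)
      = Matrix.diagonal (d ∘ ⇑σ⁻¹) := by
  change σ⁻¹.permMatrix B * Matrix.diagonal d * star (σ⁻¹.permMatrix B) = _
  rw [Matrix.star_eq_conjTranspose, Matrix.conjTranspose_permMatrix, inv_inv,
    PEquiv.toMatrix_toPEquiv_mul, PEquiv.mul_toMatrix_toPEquiv, Matrix.submatrix_submatrix]
  exact Matrix.submatrix_diagonal_equiv d σ⁻¹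

variable [Algebra ℂ B]

/-- The direct sum of the *-homomorphisms `φ i`, by diagonal matrices. -/
def diagonalHom (φ : n → A →⋆ₙₐ[ℂ] B) : A →⋆ₙₐ[ℂ] Matrix n n B where
  toFun a := .diagonal fun i => φ i a
  map_smul' c a := by simp [← Matrix.diagonal_smul, Pi.smul_def]
  map_zero' := by simp
  map_add' a b := by simp
  map_mul' a b := by simp
  map_star' a := by
    simp [Matrix.star_eq_conjTranspose, Matrix.diagonal_conjTranspose, map_star, Pi.star_def]

/-- The regular covariant homomorphism induced by `j : A → B`. On functions `ξ : ℤ₂ → B` it reads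
`(a ξ) r = j (α r⁻¹ a) * ξ r` and `(s ξ) r = ξ (s⁻¹ r)`. -/
def regular (α : ℤˣ →* (A ≃⋆ₐ[ℂ] A)) (j : A →⋆ₙₐ[ℂ] B) : CovHom α (Matrix ℤˣ ℤˣ B) where
  π := diagonalHom fun r => j.comp (α r⁻¹ : A →⋆ₙₐ[ℂ] A)
  U := (permUnitary ℤˣ B).comp (MulAction.toPermHom ℤˣ ℤˣ)
  covariant s a := by
    refine .trans (congrArg Matrix.diagonal (funext fun r => ?_))
      (permUnitary_mul_diagonal_mul_star _ _).symm
    change j (α r⁻¹ (α s a)) = j (α (s⁻¹ * r)⁻¹ a)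
    rw [act_act, mul_inv_rev, inv_inv]

lemma integral_regular_apply (j : A →⋆ₙₐ[ℂ] B) (f : ConvAlg α) (r t : ℤˣ) :
    (regular α j).integral f r t = (1 / 2 : ℂ) • j (α r⁻¹ (f (r * t⁻¹))) := by
  change ((1 / 2 : ℂ) • ∑ s : ℤˣ, Matrix.diagonal (fun r => j (α r⁻¹ (f s))) *
    (MulAction.toPerm s)⁻¹.permMatrix B : Matrix ℤˣ ℤˣ B) r t = _
  have h_iff (s : ℤˣ) : r = s * t ↔ s = r * t⁻¹ := by rw [eq_mul_inv_iff_mul_eq, eq_comm]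
  simp only [PEquiv.mul_toMatrix_toPEquiv, Matrix.smul_apply, Matrix.sum_apply,
    Matrix.submatrix_apply, Matrix.diagonal_apply, id_eq, Equiv.Perm.inv_def, Equiv.symm_symm,
    MulAction.toPerm_apply, smul_eq_mul, h_iff, Finset.sum_ite_eq', Finset.mem_univ, if_true]

end Regular

end CovHom

namespace ConvAlg

lemma norm_apply_le (f : ConvAlg α) (s : ℤˣ) : ‖f s‖ ≤ 2 * ‖f‖ := by
  let _ : PartialOrder (Unitization ℂ A) := CStarAlgebra.spectralOrder _
  have : StarOrderedRing (Unitization ℂ A) := CStarAlgebra.spectralOrderedRing _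
  let ψ := (CovHom.regular α (Unitization.inrNonUnitalStarAlgHom ℂ A)).map
    CStarMatrix.ofMatrixStarAlgEquiv.toStarAlgHom
  have h : (1 / 2) * ‖f s‖ ≤ ‖f‖ := calc
    (1 / 2) * ‖f s‖ = ‖ψ.integral f 1 s⁻¹‖ := by
      rw [CovHom.integral_map]
      change _ = ‖(CovHom.regular α _).integral f 1 s⁻¹‖
      rw [CovHom.integral_regular_apply]
      simp [norm_smul, Unitization.norm_inr]
    _ ≤ ‖ψ.integral f‖ := CStarMatrix.norm_entry_le_norm
    _ ≤ ‖f‖ := ψ.norm_integral_le f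
  linarith

lemma norm_le_sum (f : ConvAlg α) : ‖f‖ ≤ (1 / 2 : ℝ) * ∑ s : ℤˣ, ‖f s‖ :=
  univNorm_le (by positivity) fun ρ => ρ.norm_integratedForm_le f

/-- The identity map from `A^{ℤ₂}` to the functions `ℤ₂ → A`. It is kept as a linear map of its
own since the two sides carry different norms. -/
def toPiₗ : ConvAlg α ≃ₗ[ℂ] (ℤˣ → A) := LinearEquiv.refl ℂ (ℤˣ → A)

/-- The identity map from `A^{ℤ₂}` with the universal norm to the functions `ℤ₂ → A` with the
supremum norm. -/
def toPi : ConvAlg α ≃L[ℂ] (ℤˣ → A) :=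
  toPiₗ.toContinuousLinearEquivOfBounds 2 1
    (fun f => (pi_norm_le_iff_of_nonneg (by positivity)).mpr (norm_apply_le f))
    fun f => calc
      ‖toPiₗ.symm f‖ ≤ (1 / 2 : ℝ) * ∑ s : ℤˣ, ‖f s‖ := norm_le_sum (toPiₗ.symm f)
      _ ≤ (1 / 2 : ℝ) * (Fintype.card ℤˣ • ‖f‖) := by gcongr; exact Pi.sum_norm_apply_le_norm f
      _ = 1 * ‖f‖ := by simp

instance instCompleteSpace : CompleteSpace (ConvAlg α) :=
  toPi.isUniformEmbedding.completeSpace_congr toPi.surjective |>.mpr inferInstance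

instance instT0Space : T0Space (ConvAlg α) := toPi.toHomeomorph.symm.t0Space

end ConvAlg

namespace CrossedProduct

lemma ι_injective : Function.Injective (ι : ConvAlg α → CrossedProduct α) :=
  isDenseInducing_ι.isInducing.injective

lemma ι_surjective : Function.Surjective (ι : ConvAlg α → CrossedProduct α) := by
  have h : IsClosed (Set.range (ι : ConvAlg α → CrossedProduct α)) :=
    ι.isometry.isUniformInducing.isComplete_range.isClosed
  rw [← Set.range_eq_univ, ← h.closure_eq, denseRange_ι.closure_range]

/-- The canonical map `A^{ℤ₂} → A ⋊_α ℤ₂` as a *-isomorphism: no completion takes place. -/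
def ιEquiv (α : ℤˣ →* (A ≃⋆ₐ[ℂ] A)) : ConvAlg α ≃⋆ₐ[ℂ] CrossedProduct α where
  __ := Equiv.ofBijective ι ⟨ι_injective, ι_surjective⟩
  map_add' := map_add ι
  map_mul' := ι_mul
  map_star' := ι_star
  map_smul' := map_smul ι

end CrossedProduct

lemma hatAlg_ext {X Y : hatAlg α} (h₀ : (X : CStarMatrix (Fin 2) (Fin 2) A) 0 0 = Y.1 0 0)
    (h₁ : (X : CStarMatrix (Fin 2) (Fin 2) A) 0 1 = Y.1 0 1) : X = Y := by
  obtain ⟨_, a, b, rfl⟩ := X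
  obtain ⟨_, c, d, rfl⟩ := Y
  obtain rfl : a = c := h₀
  obtain rfl : b = d := h₁
  rfl

/-- The *-isomorphism `f ↦ ½ [[f(1), f(-1)], [α₋₁(f(-1)), α₋₁(f(1))]]` from `A^{ℤ₂}` onto `Â`. -/
def convAlgEquivHatAlg (α : ℤˣ →* (A ≃⋆ₐ[ℂ] A)) : ConvAlg α ≃⋆ₐ[ℂ] hatAlg α where
  toFun f := ⟨CStarMatrix.ofMatrix !![(1 / 2 : ℂ) • f 1, (1 / 2 : ℂ) • f (-1);
    α (-1) ((1 / 2 : ℂ) • f (-1)), α (-1) ((1 / 2 : ℂ) • f 1)], _, _, rfl⟩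
  invFun X s := (2 : ℂ) • if s = 1 then X.1 0 0 else X.1 0 1
  left_inv f := by
    ext s
    rcases Int.units_eq_one_or s with rfl | rfl <;> simp [smul_smul]
  right_inv X := hatAlg_ext (by simp [smul_smul]) (by simp [smul_smul])
  map_add' f g := hatAlg_ext (by simp) (by simp)
  map_mul' f g := hatAlg_ext
    (by simp [CStarMatrix.mul_apply, ConvAlg.mul_apply, act_act, smul_smul, smul_mul_assoc,
      mul_smul_comm])
    (by simp [CStarMatrix.mul_apply, ConvAlg.mul_apply, act_act, smul_smul, smul_mul_assoc,
      mul_smul_comm])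
  map_star' f := by
    apply hatAlg_ext <;> simp [CStarMatrix.star_apply, ConvAlg.star_apply, act_act, ← map_star]
  map_smul' c f := hatAlg_ext (by simp [smul_comm c]) (by simp [smul_comm c])

end Z2Crossed

end

theorem mainTheorem4_general {A : Type u} [NonUnitalCStarAlgebra A]
    (α : ℤˣ →* (A ≃⋆ₐ[ℂ] A)) :
    (∀ (B : Type v) [Add B] [Mul B] [SMul ℂ B] [Star B],
      Nonempty (B ≃⋆ₐ[ℂ] Z2Crossed.ConvAlg α) →
        Nonempty (Z2Crossed.CrossedProduct α ≃⋆ₐ[ℂ] B)) ∧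
    Nonempty (Z2Crossed.CrossedProduct α ≃⋆ₐ[ℂ] Z2Crossed.hatAlg α) := by
  have e := (Z2Crossed.CrossedProduct.ιEquiv α).symm
  exact ⟨fun B _ _ _ _ ⟨e'⟩ => ⟨e.trans e'.symm⟩, ⟨e.trans (Z2Crossed.convAlgEquivHatAlg α)⟩⟩

theorem mainTheorem4 {A : Type u} [NonUnitalCStarAlgebra A]
    (α : ℤˣ →* (A ≃⋆ₐ[ℂ] A)) :
    (∀ (B : Type v) [NonUnitalCStarAlgebra B],
      Nonempty (B ≃⋆ₐ[ℂ] Z2Crossed.ConvAlg α) →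
        Nonempty (Z2Crossed.CrossedProduct α ≃⋆ₐ[ℂ] B)) ∧
    Nonempty (Z2Crossed.CrossedProduct α ≃⋆ₐ[ℂ] Z2Crossed.hatAlg α) :=
  ⟨fun B _ => (mainTheorem4_general.{u, v} α).1 B, (mainTheorem4_general.{u, v} α).2⟩
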